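/- Let $\mathcal H$ and $\mathcal K$ be finite-dimensional complex Hilbert spaces, let $N=\dim\mathcal H\ge 1$, and let $U$ be a unitary operator on $\mathcal H\otimes\mathcal K$. For $f,g\in\mathcal H$ and an operator $T$ on $\mathcal H\otimes\mathcal K$, let $T(f,g)$ be the operator on $\mathcal K$ determined by $\langle\varphi, T(f,g)\psi\rangle=\langle f\otimes\varphi, T(g\otimes\psi)\rangle$ for all $\varphi,\psi\in\mathcal K$ (that is, $T(f,g)=\mathrm{Tr}_{|g\rangle\langle f|}[T]$). For a set $\mathcal S\subset\mathcal B(\mathcal K)$ let $\mathcal S'$ denote its commutant in $\mathcal B(\mathcal K)$, and put $$\mathcal A(U)=\{U(f,g),\,U^*(f,g)\;:\;f,g\in\mathcal H\}'',\qquad \mathcal A_r(U)=\{U^*(f_1,g_1)\,U(f_2,g_2)\;:\;f_1,g_1,f_2,g_2\in\mathcal H\}''.$$ With $\mathrm{Tr}_{\mathcal H}:\mathcal B(\mathcal H\otimes\mathcal K)\to\mathcal B(\mathcal K)$ the partial trace over $\mathcal H$, define for $X\in\mathcal B(\mathcal K)$ $$\mathcal L(X)=\mathrm{Tr}_{\mathcal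 H}\!\left[U\left(\tfrac1N I_{\mathcal H}\otimes X\right)U^*\right],\qquad \mathcal L^*(X)=\mathrm{Tr}_{\mathcal H}\!\left[U^*\left(\tfrac1N I_{\mathcal H}\otimes X\right)U\right].$$ Then $\mathcal L^*$ is the adjoint of $\mathcal L$ for the Hilbert–Schmidt scalar product $(X,Y)\mapsto\mathrm{Tr}[X^*Y]$ on $\mathcal B(\mathcal K)$, and: 1. $\mathcal A(U)'=\{X\in\mathcal B(\mathcal K):\mathcal L(X)=X\}=\{X\in\mathcal B(\mathcal K):\mathcal L^*(X)=X\}$, i.e. $\mathcal A(U)'$ is the eigenspace of $\mathcal L$, and also the eigenspace of $\mathcal L^*$, for the eigenvalue $1$; 2. $\mathcal A_r(U)'$ is the right-singular space of $\mathcal L$ for the singular value $1$, i.e. $\mathcal A_r(U)'=\{X\in\mathcal B(\mathcal K):\text{there is }X'\in\mathcal B(\mathcal K)\text{ with }\mathcal L(X)=X'\text{ and }\mathcal L^*(X')=X\}$. -/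

import Mathlib

open scoped TensorProduct

noncomputable section

namespace EnvAlg

variable {H K : Type*}
  [NormedAddCommGroup H] [InnerProductSpace ℂ H] [FiniteDimensional ℂ H]
  [NormedAddCommGroup K] [InnerProductSpace ℂ K] [FiniteDimensional ℂ K]

/-- The weighted partial trace `Tr_ω` over `H`: the linear map `B(H ⊗ K) → B(K)` which sends
`A ⊗ B` to `Tr[ω A] B`. -/
def partialTraceAgainst (ω : H →ₗ[ℂ] H) :
    ((H ⊗[ℂ] K) →ₗ[ℂ] (H ⊗[ℂ] K)) →ₗ[ℂ] (K →ₗ[ℂ] K) :=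
  (TensorProduct.lid ℂ (K →ₗ[ℂ] K)).toLinearMap ∘ₗ
    LinearMap.rTensor (K →ₗ[ℂ] K) (LinearMap.trace ℂ H ∘ₗ LinearMap.mulLeft ℂ ω) ∘ₗ
      (homTensorHomEquiv ℂ H K H K).symm.toLinearMap

/-- The partial trace `Tr_H : B(H ⊗ K) → B(K)`. -/
def partialTrace : ((H ⊗[ℂ] K) →ₗ[ℂ] (H ⊗[ℂ] K)) →ₗ[ℂ] (K →ₗ[ℂ] K) :=
  partialTraceAgainst (1 : H →ₗ[ℂ] H)

theorem partialTraceAgainst_map (ω A : H →ₗ[ℂ] H) (B : K →ₗ[ℂ] K) :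
    partialTraceAgainst ω (TensorProduct.map A B) = LinearMap.trace ℂ H (ω * A) • B := by
  have h : TensorProduct.map A B = homTensorHomEquiv ℂ H K H K (A ⊗ₜ[ℂ] B) := by
    rw [homTensorHomEquiv_apply]; rfl
  unfold partialTraceAgainst
  rw [h, LinearMap.comp_apply, LinearMap.comp_apply, LinearEquiv.coe_toLinearMap,
    LinearEquiv.coe_toLinearMap, LinearEquiv.symm_apply_apply, LinearMap.rTensor_tmul,
    TensorProduct.lid_tmul]
  rfl

/-- The defining duality of the partial trace. -/
theorem trace_partialTraceAgainst_mul (ω : H →ₗ[ℂ] H)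
    (T : (H ⊗[ℂ] K) →ₗ[ℂ] (H ⊗[ℂ] K)) (Y : K →ₗ[ℂ] K) :
    LinearMap.trace ℂ K (partialTraceAgainst ω T * Y) =
      LinearMap.trace ℂ (H ⊗[ℂ] K) (T * TensorProduct.map ω Y) := by
  obtain ⟨t, rfl⟩ := (homTensorHomEquiv ℂ H K H K).surjective T
  induction t with
  | zero => simp
  | add x y hx hy => simp only [map_add, add_mul, hx, hy]
  | tmul A B =>
    have h : homTensorHomEquiv ℂ H K H K (A ⊗ₜ[ℂ] B) = TensorProduct.map A B := by
      rw [homTensorHomEquiv_apply]; rfl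
    rw [h, partialTraceAgainst_map, ← TensorProduct.map_mul, LinearMap.trace_tensorProduct',
      LinearMap.trace_mul_comm ℂ A ω]
    simp

/-- The operator `T(f, g) = Tr_{|g⟩⟨f|}[T]` on `K`. -/
def slice (T : (H ⊗[ℂ] K) →ₗ[ℂ] (H ⊗[ℂ] K)) (f g : H) : K →ₗ[ℂ] K :=
  partialTraceAgainst (InnerProductSpace.rankOne ℂ g f : H →L[ℂ] H).toLinearMap T

/-- The environment algebra `A(U) = {U(f, g), U*(f, g)}''`. -/
def envAlgebra (U : (H ⊗[ℂ] K) →ₗ[ℂ] (H ⊗[ℂ] K)) : Subalgebra ℂ (K →ₗ[ℂ] K) :=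
  Subalgebra.centralizer ℂ (Subalgebra.centralizer ℂ
    {Y : K →ₗ[ℂ] K | ∃ f g : H, Y = slice U f g ∨ Y = slice (star U) f g} : Set (K →ₗ[ℂ] K))

/-- The environment right-action algebra `A_r(U) = {U*(f₁, g₁) U(f₂, g₂)}''`. -/
def envRightActionAlgebra (U : (H ⊗[ℂ] K) →ₗ[ℂ] (H ⊗[ℂ] K)) : Subalgebra ℂ (K →ₗ[ℂ] K) :=
  Subalgebra.centralizer ℂ (Subalgebra.centralizer ℂ
    {Y : K →ₗ[ℂ] K | ∃ f₁ g₁ f₂ g₂ : H, Y = slice (star U) f₁ g₁ * slice U f₂ g₂} :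
      Set (K →ₗ[ℂ] K))

/-- The commutant `A'`, as a linear subspace of `B(K)`. -/
def commutant (A : Subalgebra ℂ (K →ₗ[ℂ] K)) : Submodule ℂ (K →ₗ[ℂ] K) :=
  Subalgebra.toSubmodule (Subalgebra.centralizer ℂ (A : Set (K →ₗ[ℂ] K)))

/-- `L(X) = Tr_H[U ((1/N) I ⊗ X) U*]`, where `N = dim H`. -/
def cpMap (U : (H ⊗[ℂ] K) →ₗ[ℂ] (H ⊗[ℂ] K)) : (K →ₗ[ℂ] K) →ₗ[ℂ] (K →ₗ[ℂ] K) where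
  toFun X := partialTrace
    (U * TensorProduct.map ((1 / (Module.finrank ℂ H : ℂ)) • (1 : H →ₗ[ℂ] H)) X * star U)
  map_add' X Y := by simp [TensorProduct.map_add_right, mul_add, add_mul]
  map_smul' c X := by
    rw [TensorProduct.map_smul_right, mul_smul_comm, smul_mul_assoc, map_smul, RingHom.id_apply]

/-- `L*(X) = Tr_H[U* ((1/N) I ⊗ X) U]`, where `N = dim H`. -/
def cpMapStar (U : (H ⊗[ℂ] K) →ₗ[ℂ] (H ⊗[ℂ] K)) : (K →ₗ[ℂ] K) →ₗ[ℂ] (K →ₗ[ℂ] K) where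
  toFun X := partialTrace
    (star U * TensorProduct.map ((1 / (Module.finrank ℂ H : ℂ)) • (1 : H →ₗ[ℂ] H)) X * U)
  map_add' X Y := by simp [TensorProduct.map_add_right, mul_add, add_mul]
  map_smul' c X := by
    rw [TensorProduct.map_smul_right, mul_smul_comm, smul_mul_assoc, map_smul, RingHom.id_apply]

/-- `S` is the adjoint of `T` for the Hilbert–Schmidt scalar product `(X, Y) ↦ Tr[X* Y]`. -/
def IsHSAdjoint (T S : (K →ₗ[ℂ] K) →ₗ[ℂ] (K →ₗ[ℂ] K)) : Prop :=
  ∀ X Y : K →ₗ[ℂ] K,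
    LinearMap.trace ℂ K (star (T X) * Y) = LinearMap.trace ℂ K (star X * S Y)

/-- The right-singular space of `T`, with adjoint `S`, for the singular value `σ`: all `X` for
which some `X'` satisfies `T X = σ X'` and `S X' = σ X`. -/
def rightSingularSpace (T S : (K →ₗ[ℂ] K) →ₗ[ℂ] (K →ₗ[ℂ] K)) (σ : ℝ) :
    Submodule ℂ (K →ₗ[ℂ] K) where
  carrier := {X | ∃ X' : K →ₗ[ℂ] K, T X = (σ : ℂ) • X' ∧ S X' = (σ : ℂ) • X}
  zero_mem' := ⟨0, by simp⟩
  add_mem' := by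
    rintro X Y ⟨X', h₁, h₂⟩ ⟨Y', h₃, h₄⟩
    exact ⟨X' + Y', by rw [map_add, h₁, h₃, smul_add], by rw [map_add, h₂, h₄, smul_add]⟩
  smul_mem' := by
    rintro c X ⟨X', h₁, h₂⟩
    exact ⟨c • X', by rw [map_smul, h₁, smul_comm], by rw [map_smul, h₂, smul_comm]⟩

end EnvAlg

end

/-!
Write `N = dim H`. The map `Y ↦ 1 ⊗ Y` is Hilbert–Schmidt adjoint to the partial trace and scales
the squared Hilbert–Schmidt norm by `N`. Hence, if `Tr_H T = N Y`, then
`‖T - 1 ⊗ Y‖² = ‖T‖² - N ‖Y‖²`. For `T = U (1 ⊗ X) U*` and `Y = L X` the right-hand side is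
`N (‖X‖² - ‖L X‖²)`, so `U` intertwines `1 ⊗ X` with `1 ⊗ Y` exactly when `L X = Y` and
`‖Y‖ = ‖X‖`. Such an equality of norms is automatic for a fixed point, and for a pair `L X = Y`,
`L* Y = X` by adjointness. On the algebraic side, `X` commutes with all slices of `U` and `U*`
exactly when `U` commutes with `1 ⊗ X`; and `U*(f₁, g₁) U(f₂, g₂)` is the `(f₁, g₂)` slice of
`U* (|g₁⟩⟨f₂| ⊗ 1) U`, so `X` commutes with all these products exactly when `U (1 ⊗ X) U*` commutes
with `B(H) ⊗ 1`, that is, when it equals some `1 ⊗ Y`.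
-/

namespace EnvAlg

open LinearMap (trace adjoint)
open InnerProductSpace (rankOne)

section Unitary

variable {M : Type*} [Monoid M]

theorem commute_iff_commute_of_semiconjBy {u : Mˣ} {x y z w : M} (hx : SemiconjBy ↑u x y)
    (hz : SemiconjBy ↑u z w) : Commute x z ↔ Commute y w := by
  rw [Commute, SemiconjBy, ← u.mul_right_inj, (hx.mul_right hz).eq, (hz.mul_right hx).eq,
    u.mul_left_inj, Commute, SemiconjBy]

variable [StarMul M] {u x y z : M} (hu : u ∈ unitary M)

include hu

theorem semiconjBy_iff_conj_eq : SemiconjBy u x y ↔ u * x * star u = y :=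
  (Units.mul_inv_eq_iff_eq_mul (Unitary.toUnits ⟨u, hu⟩)).symm

theorem semiconjBy_star_iff : SemiconjBy (star u) y x ↔ SemiconjBy u x y :=
  SemiconjBy.units_inv_symm_left_iff (a := Unitary.toUnits ⟨u, hu⟩)

theorem commute_star_conj_iff_commute_conj :
    Commute (star u * z * u) x ↔ Commute z (u * x * star u) := by
  have hz : SemiconjBy u (star u * z * u) z := by
    rw [SemiconjBy, ← mul_assoc, ← mul_assoc, Unitary.mul_star_self_of_mem hu, one_mul]
  have hx : SemiconjBy u x (u * x * star u) := (semiconjBy_iff_conj_eq hu).mpr rfl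
  exact commute_iff_commute_of_semiconjBy (u := Unitary.toUnits ⟨u, hu⟩) hz hx

end Unitary

section Trace

variable {𝕜 E : Type*} [RCLike 𝕜] [NormedAddCommGroup E] [InnerProductSpace 𝕜 E]
  [FiniteDimensional 𝕜 E]

theorem trace_star (A : E →ₗ[𝕜] E) : trace 𝕜 E (star A) = star (trace 𝕜 E A) := by
  let b := stdOrthonormalBasis 𝕜 E
  rw [LinearMap.trace_eq_matrix_trace 𝕜 b.toBasis, LinearMap.trace_eq_matrix_trace 𝕜 b.toBasis,
    LinearMap.star_eq_adjoint, LinearMap.toMatrix_adjoint, Matrix.trace_conjTranspose]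

theorem trace_star_mul_comm (A B : E →ₗ[𝕜] E) :
    trace 𝕜 E (star A * B) = star (trace 𝕜 E (star B * A)) := by
  rw [← trace_star, star_mul, star_star]

open scoped ComplexOrder in
theorem trace_star_mul_self_eq_zero_iff {A : E →ₗ[𝕜] E} :
    trace 𝕜 E (star A * A) = 0 ↔ A = 0 := by
  let b := stdOrthonormalBasis 𝕜 E
  rw [LinearMap.trace_eq_matrix_trace 𝕜 b.toBasis, LinearMap.toMatrix_mul,
    LinearMap.star_eq_adjoint, LinearMap.toMatrix_adjoint,
    Matrix.trace_conjTranspose_mul_self_eq_zero_iff, LinearEquiv.map_eq_zero_iff]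

theorem trace_star_conj_mul (U A B : E →ₗ[𝕜] E) :
    trace 𝕜 E (star (U * A * star U) * B) = trace 𝕜 E (star A * (star U * B * U)) := by
  rw [star_mul, star_mul, star_star, mul_assoc, LinearMap.trace_mul_comm]
  simp only [mul_assoc]

theorem trace_star_conj_mul_conj {U : E →ₗ[𝕜] E} (hU : U ∈ unitary (E →ₗ[𝕜] E))
    (A : E →ₗ[𝕜] E) :
    trace 𝕜 E (star (U * A * star U) * (U * A * star U)) = trace 𝕜 E (star A * A) := by
  have hA : star U * (U * A * star U) * U = A := by
    simp only [mul_assoc, Unitary.star_mul_self_of_mem hU, mul_one]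
    rw [← mul_assoc, Unitary.star_mul_self_of_mem hU, one_mul]
  rw [trace_star_conj_mul, hA]

end Trace

section Contraction

variable {𝕜 E F : Type*} [RCLike 𝕜]
  [NormedAddCommGroup E] [InnerProductSpace 𝕜 E] [FiniteDimensional 𝕜 E]
  [NormedAddCommGroup F] [InnerProductSpace 𝕜 F] [FiniteDimensional 𝕜 F]

theorem adjoint_mk_tmul (x y : E) (z : F) :
    adjoint (TensorProduct.mk 𝕜 E F x) (y ⊗ₜ[𝕜] z) = inner 𝕜 x y • z := by
  refine ext_inner_left 𝕜 fun w ↦ ?_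
  simp [LinearMap.adjoint_inner_right, inner_smul_right]

theorem adjoint_mk_lTensor (x : E) (B : F →ₗ[𝕜] F) (t : E ⊗[𝕜] F) :
    adjoint (TensorProduct.mk 𝕜 E F x) (B.lTensor E t) =
      B (adjoint (TensorProduct.mk 𝕜 E F x) t) := by
  induction t with
  | zero => simp
  | add s t hs ht => simp only [map_add, hs, ht]
  | tmul y z => simp [adjoint_mk_tmul]

theorem rTensor_rankOne (x y : E) (t : E ⊗[𝕜] F) :
    (rankOne 𝕜 x y).toLinearMap.rTensor F t =
      x ⊗ₜ[𝕜] adjoint (TensorProduct.mk 𝕜 E F y) t := by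
  induction t with
  | zero => simp
  | add s t hs ht => simp only [map_add, hs, ht, TensorProduct.tmul_add]
  | tmul z w => simp [adjoint_mk_tmul, TensorProduct.smul_tmul]

theorem forall_commute_rTensor_rankOne_iff {T : E ⊗[𝕜] F →ₗ[𝕜] E ⊗[𝕜] F} :
    (∀ x y : E, Commute ((rankOne 𝕜 x y).toLinearMap.rTensor F) T) ↔
      ∃ B : F →ₗ[𝕜] F, T = B.lTensor E := by
  refine ⟨fun h ↦ ?_, ?_⟩
  · rcases subsingleton_or_nontrivial E with _ | _
    · exact ⟨0, TensorProduct.ext' fun x z ↦ by simp [Subsingleton.elim x 0]⟩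
    let b := stdOrthonormalBasis 𝕜 E
    obtain ⟨i⟩ := b.toBasis.index_nonempty
    let ι := TensorProduct.mk 𝕜 E F (b i)
    refine ⟨adjoint ι ∘ₗ T ∘ₗ ι, TensorProduct.ext' fun x z ↦ ?_⟩
    calc T (x ⊗ₜ[𝕜] z)
        = T ((rankOne 𝕜 x (b i)).toLinearMap.rTensor F (b i ⊗ₜ[𝕜] z)) := by simp
      _ = (rankOne 𝕜 x (b i)).toLinearMap.rTensor F (T (b i ⊗ₜ[𝕜] z)) :=
        (LinearMap.congr_fun (h x (b i)).eq (b i ⊗ₜ[𝕜] z)).symm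
      _ = x ⊗ₜ[𝕜] adjoint ι (T (b i ⊗ₜ[𝕜] z)) := rTensor_rankOne x (b i) _
  · rintro ⟨B, rfl⟩ x y
    exact (LinearMap.rTensor_comp_lTensor ..).trans (LinearMap.lTensor_comp_rTensor ..).symm

end Contraction

variable {H K : Type*}
  [NormedAddCommGroup H] [InnerProductSpace ℂ H] [FiniteDimensional ℂ H]
  [NormedAddCommGroup K] [InnerProductSpace ℂ K] [FiniteDimensional ℂ K]

section Slice

variable (S T : H ⊗[ℂ] K →ₗ[ℂ] H ⊗[ℂ] K) (f g : H)

theorem slice_eq_adjoint_mk_comp :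
    slice T f g = adjoint (TensorProduct.mk ℂ H K f) ∘ₗ T ∘ₗ TensorProduct.mk ℂ H K g := by
  obtain ⟨t, rfl⟩ := (homTensorHomEquiv ℂ H K H K).surjective T
  induction t with
  | zero => simp [slice]
  | add s t hs ht =>
    rw [slice] at hs ht ⊢
    simp only [map_add, hs, ht, LinearMap.add_comp, LinearMap.comp_add]
  | tmul A B =>
    ext ψ
    have hA : A * (rankOne ℂ g f).toLinearMap = (rankOne ℂ (A g) f).toLinearMap := by
      ext x; simp
    rw [slice, homTensorHomEquiv_apply, TensorProduct.homTensorHomMap_apply,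
      partialTraceAgainst_map, LinearMap.trace_mul_comm, hA, InnerProductSpace.trace_rankOne]
    simp [adjoint_mk_tmul]

variable {S T} in
theorem ext_slice (h : ∀ f g, slice S f g = slice T f g) : S = T := by
  refine TensorProduct.ext' fun g ψ ↦ TensorProduct.ext_iff_inner_left.mpr fun f φ ↦ ?_
  have hφ := congrArg (inner ℂ φ) (LinearMap.congr_fun (h f g) ψ)
  simpa only [slice_eq_adjoint_mk_comp, LinearMap.comp_apply, LinearMap.adjoint_inner_right,
    TensorProduct.mk_apply] using hφ

theorem slice_mul_lTensor (X : K →ₗ[ℂ] K) :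
    slice (T * X.lTensor H) f g = slice T f g * X := by
  simp only [slice_eq_adjoint_mk_comp]
  rfl

theorem slice_lTensor_mul (X : K →ₗ[ℂ] K) :
    slice (X.lTensor H * T) f g = X * slice T f g := by
  ext ψ
  simp only [slice_eq_adjoint_mk_comp]
  exact adjoint_mk_lTensor f X _

theorem slice_mul_rTensor_rankOne_mul (x y : H) :
    slice (S * (rankOne ℂ x y).toLinearMap.rTensor K * T) f g = slice S f x * slice T y g := by
  ext ψ
  simp only [slice_eq_adjoint_mk_comp]
  simp [rTensor_rankOne]

theorem semiconjBy_lTensor_iff_slice (X Y : K →ₗ[ℂ] K) :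
    SemiconjBy T (X.lTensor H) (Y.lTensor H) ↔ ∀ f g, SemiconjBy (slice T f g) X Y := by
  simp only [SemiconjBy, ← slice_mul_lTensor, ← slice_lTensor_mul]
  exact ⟨fun h f g ↦ by rw [h], ext_slice⟩

end Slice

section PartialTrace

variable (T : H ⊗[ℂ] K →ₗ[ℂ] H ⊗[ℂ] K) (Y : K →ₗ[ℂ] K)

theorem partialTrace_lTensor :
    partialTrace (Y.lTensor H) = (Module.finrank ℂ H : ℂ) • Y := by
  rw [partialTrace, LinearMap.lTensor, partialTraceAgainst_map, one_mul, ← Module.End.one_eq_id,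
    LinearMap.trace_one]

theorem trace_star_lTensor_mul :
    trace ℂ (H ⊗[ℂ] K) (star (Y.lTensor H) * T) = trace ℂ K (star Y * partialTrace T) := by
  rw [LinearMap.star_eq_adjoint, LinearMap.adjoint_lTensor, LinearMap.trace_mul_comm,
    LinearMap.trace_mul_comm ℂ (star Y)]
  exact (trace_partialTraceAgainst_mul 1 T (star Y)).symm

theorem trace_star_mul_lTensor :
    trace ℂ (H ⊗[ℂ] K) (star T * Y.lTensor H) = trace ℂ K (star (partialTrace T) * Y) := by
  rw [trace_star_mul_comm, trace_star_lTensor_mul, ← trace_star_mul_comm]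

variable {T Y} in
/-- Pythagoras: `N⁻¹ Tr_H T` is the coefficient of the orthogonal projection of `T` onto
`1 ⊗ B(K)`. -/
theorem trace_star_sub_lTensor_mul_sub_lTensor
    (hT : partialTrace T = (Module.finrank ℂ H : ℂ) • Y) :
    trace ℂ (H ⊗[ℂ] K) (star (T - Y.lTensor H) * (T - Y.lTensor H)) =
      trace ℂ (H ⊗[ℂ] K) (star T * T) - Module.finrank ℂ H * trace ℂ K (star Y * Y) := by
  have hTY : trace ℂ (H ⊗[ℂ] K) (star T * Y.lTensor H) =
      Module.finrank ℂ H * trace ℂ K (star Y * Y) := by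
    simp [trace_star_mul_lTensor, hT]
  have hYT : trace ℂ (H ⊗[ℂ] K) (star (Y.lTensor H) * T) =
      Module.finrank ℂ H * trace ℂ K (star Y * Y) := by
    simp [trace_star_lTensor_mul, hT]
  have hYY : trace ℂ (H ⊗[ℂ] K) (star (Y.lTensor H) * Y.lTensor H) =
      Module.finrank ℂ H * trace ℂ K (star Y * Y) := by
    simp [trace_star_lTensor_mul, partialTrace_lTensor]
  rw [star_sub T, sub_mul, mul_sub, mul_sub, map_sub, map_sub, map_sub, hTY, hYT, hYY, sub_self,
    sub_zero]

end PartialTrace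

section CpMap

variable (U : H ⊗[ℂ] K →ₗ[ℂ] H ⊗[ℂ] K)

theorem cpMap_apply (X : K →ₗ[ℂ] K) :
    cpMap U X = (Module.finrank ℂ H : ℂ)⁻¹ • partialTrace (U * X.lTensor H * star U) := by
  change partialTrace _ = _
  rw [TensorProduct.map_smul_left, mul_smul_comm, smul_mul_assoc, map_smul, one_div]
  rfl

theorem cpMapStar_eq_cpMap_star : cpMapStar U = cpMap (star U) := by
  ext1 X
  change partialTrace _ = partialTrace (_ * star (star U))
  rw [star_star U]

theorem isHSAdjoint_cpMap : IsHSAdjoint (cpMap U) (cpMapStar U) := by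
  intro X Y
  have h : trace ℂ K (star (partialTrace (U * X.lTensor H * star U)) * Y) =
      trace ℂ K (star X * partialTrace (star U * Y.lTensor H * U)) := by
    rw [← trace_star_mul_lTensor, trace_star_conj_mul, trace_star_lTensor_mul]
  rw [cpMapStar_eq_cpMap_star, cpMap_apply, cpMap_apply, star_star U]
  simp [h]

variable {U}

/-- The equality case of the contractivity of `L`. -/
theorem semiconjBy_lTensor_iff_cpMap [Nontrivial H]
    (hU : U ∈ unitary (H ⊗[ℂ] K →ₗ[ℂ] H ⊗[ℂ] K)) {X Y : K →ₗ[ℂ] K} :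
    SemiconjBy U (X.lTensor H) (Y.lTensor H) ↔
      cpMap U X = Y ∧ trace ℂ K (star Y * Y) = trace ℂ K (star X * X) := by
  have hN : (Module.finrank ℂ H : ℂ) ≠ 0 := Nat.cast_ne_zero.mpr Module.finrank_pos.ne'
  have norm_eq_iff (h : cpMap U X = Y) : U * X.lTensor H * star U = Y.lTensor H ↔
      trace ℂ K (star Y * Y) = trace ℂ K (star X * X) := by
    have hTr : partialTrace (U * X.lTensor H * star U) = (Module.finrank ℂ H : ℂ) • Y := by
      rw [← h, cpMap_apply, smul_inv_smul₀ hN]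
    rw [← sub_eq_zero, ← trace_star_mul_self_eq_zero_iff,
      trace_star_sub_lTensor_mul_sub_lTensor hTr, trace_star_conj_mul_conj hU,
      trace_star_lTensor_mul, partialTrace_lTensor, mul_smul_comm, map_smul, smul_eq_mul,
      ← mul_sub, mul_eq_zero_iff_left hN, sub_eq_zero, eq_comm]
  rw [semiconjBy_iff_conj_eq hU]
  refine ⟨fun h ↦ ?_, fun h ↦ (norm_eq_iff h.1).mpr h.2⟩
  have hL : cpMap U X = Y := by rw [cpMap_apply, h, partialTrace_lTensor, inv_smul_smul₀ hN]
  exact ⟨hL, (norm_eq_iff hL).mp h⟩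

theorem mem_eigenspace_cpMap_iff [Nontrivial H] (hU : U ∈ unitary (H ⊗[ℂ] K →ₗ[ℂ] H ⊗[ℂ] K))
    {X : K →ₗ[ℂ] K} :
    X ∈ Module.End.eigenspace (cpMap U) 1 ↔ Commute U (X.lTensor H) := by
  rw [Commute, semiconjBy_lTensor_iff_cpMap hU, Module.End.mem_eigenspace_iff, one_smul,
    and_iff_left rfl]

theorem mem_rightSingularSpace_cpMap_iff [Nontrivial H]
    (hU : U ∈ unitary (H ⊗[ℂ] K →ₗ[ℂ] H ⊗[ℂ] K)) {X : K →ₗ[ℂ] K} :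
    X ∈ rightSingularSpace (cpMap U) (cpMapStar U) 1 ↔
      ∃ Y : K →ₗ[ℂ] K, SemiconjBy U (X.lTensor H) (Y.lTensor H) := by
  change (∃ Y, cpMap U X = ((1 : ℝ) : ℂ) • Y ∧ cpMapStar U Y = ((1 : ℝ) : ℂ) • X) ↔ _
  simp only [Complex.ofReal_one, one_smul]
  refine exists_congr fun Y ↦ ⟨?_, fun h ↦ ?_⟩
  · rintro ⟨hX, hY⟩
    have hnorm : trace ℂ K (star Y * Y) = trace ℂ K (star X * X) := by
      nth_rw 1 [← hX]
      rw [isHSAdjoint_cpMap, hY]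
    exact (semiconjBy_lTensor_iff_cpMap hU).mpr ⟨hX, hnorm⟩
  · have hX := (semiconjBy_lTensor_iff_cpMap hU).mp h
    have hY := (semiconjBy_lTensor_iff_cpMap (Unitary.star_mem hU)).mp
      ((semiconjBy_star_iff hU).mpr h)
    exact ⟨hX.1, by rw [cpMapStar_eq_cpMap_star, hY.1]⟩

end CpMap

section Commutant

theorem mem_commutant_bicommutant_iff {K : Type*} [NormedAddCommGroup K] [InnerProductSpace ℂ K]
    {S : Set (K →ₗ[ℂ] K)} {X : K →ₗ[ℂ] K} :
    X ∈ commutant (Subalgebra.centralizer ℂ (Subalgebra.centralizer ℂ S : Set (K →ₗ[ℂ] K))) ↔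
      ∀ Y ∈ S, Commute Y X := by
  change X ∈ S.centralizer.centralizer.centralizer ↔ _
  rw [Set.centralizer_centralizer_centralizer]
  rfl

variable {U : H ⊗[ℂ] K →ₗ[ℂ] H ⊗[ℂ] K} (hU : U ∈ unitary (H ⊗[ℂ] K →ₗ[ℂ] H ⊗[ℂ] K))
  {X : K →ₗ[ℂ] K}

include hU

theorem mem_commutant_envAlgebra_iff :
    X ∈ commutant (envAlgebra U) ↔ Commute U (X.lTensor H) := by
  rw [envAlgebra, mem_commutant_bicommutant_iff]
  refine ⟨fun h ↦ (semiconjBy_lTensor_iff_slice U X X).mpr fun f g ↦ h _ ⟨f, g, .inl rfl⟩, ?_⟩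
  rintro h _ ⟨f, g, rfl | rfl⟩
  · exact (semiconjBy_lTensor_iff_slice U X X).mp h f g
  · exact (semiconjBy_lTensor_iff_slice (star U) X X).mp ((semiconjBy_star_iff hU).mpr h) f g

theorem mem_commutant_envRightActionAlgebra_iff :
    X ∈ commutant (envRightActionAlgebra U) ↔
      ∃ Y : K →ₗ[ℂ] K, SemiconjBy U (X.lTensor H) (Y.lTensor H) := by
  let E (x y : H) := (rankOne ℂ x y).toLinearMap.rTensor K
  calc X ∈ commutant (envRightActionAlgebra U)
      ↔ ∀ f₁ g₁ f₂ g₂, Commute (slice (star U) f₁ g₁ * slice U f₂ g₂) X := by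
        rw [envRightActionAlgebra, mem_commutant_bicommutant_iff]
        exact ⟨fun h f₁ g₁ f₂ g₂ ↦ h _ ⟨f₁, g₁, f₂, g₂, rfl⟩,
          fun h _ ⟨f₁, g₁, f₂, g₂, hY⟩ ↦ hY ▸ h f₁ g₁ f₂ g₂⟩
    _ ↔ ∀ x y, Commute (star U * E x y * U) (X.lTensor H) := by
        simp only [Commute, semiconjBy_lTensor_iff_slice, E, slice_mul_rTensor_rankOne_mul]
        exact ⟨fun h x y f g ↦ h f x y g, fun h f x y g ↦ h x y f g⟩
    _ ↔ ∀ x y, Commute (E x y) (U * X.lTensor H * star U) :=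
        forall₂_congr fun x y ↦ commute_star_conj_iff_commute_conj hU
    _ ↔ ∃ Y : K →ₗ[ℂ] K, U * X.lTensor H * star U = Y.lTensor H :=
        forall_commute_rTensor_rankOne_iff
    _ ↔ ∃ Y : K →ₗ[ℂ] K, SemiconjBy U (X.lTensor H) (Y.lTensor H) :=
        exists_congr fun Y ↦ (semiconjBy_iff_conj_eq hU).symm

end Commutant

end EnvAlg

theorem theorem3p10 {H K : Type*}
    [NormedAddCommGroup H] [InnerProductSpace ℂ H] [FiniteDimensional ℂ H] [Nontrivial H]
    [NormedAddCommGroup K] [InnerProductSpace ℂ K] [FiniteDimensional ℂ K]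
    (U : (H ⊗[ℂ] K) →ₗ[ℂ] (H ⊗[ℂ] K))
    (hU : U ∈ unitary ((H ⊗[ℂ] K) →ₗ[ℂ] (H ⊗[ℂ] K))) :
    EnvAlg.IsHSAdjoint (EnvAlg.cpMap U) (EnvAlg.cpMapStar U) ∧
    (EnvAlg.commutant (EnvAlg.envAlgebra U) = Module.End.eigenspace (EnvAlg.cpMap U) 1 ∧
      EnvAlg.commutant (EnvAlg.envAlgebra U) = Module.End.eigenspace (EnvAlg.cpMapStar U) 1) ∧
    EnvAlg.commutant (EnvAlg.envRightActionAlgebra U) =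
      EnvAlg.rightSingularSpace (EnvAlg.cpMap U) (EnvAlg.cpMapStar U) 1 := by
  refine ⟨EnvAlg.isHSAdjoint_cpMap U, ⟨?_, ?_⟩, ?_⟩ <;> ext X
  · rw [EnvAlg.mem_commutant_envAlgebra_iff hU, EnvAlg.mem_eigenspace_cpMap_iff hU]
  · rw [EnvAlg.mem_commutant_envAlgebra_iff hU, EnvAlg.cpMapStar_eq_cpMap_star,
      EnvAlg.mem_eigenspace_cpMap_iff (Unitary.star_mem hU)]
    exact (EnvAlg.semiconjBy_star_iff hU).symm
  · rw [EnvAlg.mem_commutant_envRightActionAlgebra_iff hU,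
      EnvAlg.mem_rightSingularSpace_cpMap_iff hU]
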